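/- Fix a set $\mathsf{Act}$ of visible actions, an internal action $\tau\notin\mathsf{Act}$, and a set $\Omega$ of success actions disjoint from $\mathsf{Act}\cup\{\tau\}$. A subdistribution over a set $S$ is a function $\Delta:S\to[0,1]$ with $\sum_s\Delta(s)\le 1$, and a distribution if the sum is $1$; $\mathcal D(S)$ is the set of distributions, $\overline{s}$ the point distribution at $s$, $\mathrm{supp}\,\Delta=\{s\mid\Delta(s)>0\}$, $\mathrm{Img}_f(\Delta)(t)=\sum_{f(s)=t}\Delta(s)$, and $\mathrm{Exp}_\Delta(g)=\sum_s\Delta(s)\,g(s)$. A probabilistic labelled transition system (pLTS) with visible actions $L$ is a set $S$ of states with a relation $\to\ \subseteq S\times(L\cup\{\tau\})\times\mathcal D(S)$; $s\xrightarrow{\alpha}$ means that $s\xrightarrow{\alpha}\Delta$ for some $\Delta$. A pLTS is deterministic if for each $s,\alpha$ there is at most one $\Delta$ with $s\xrightarrow{\alpha}\Delta$. A process is a distribution over the states $P$ of a pLTS with visible actions $\mathsf{Act}$. A test is a distribution over the states $T$ of a pLTS with visible actions $\mathsf{Act}\cup\Omega$ such that (A) $t\xrightarrow{\omega_1}$ and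 $t\xrightarrow{\omega_2}$ with $\omega_1,\omega_2\in\Omega$ imply $\omega_1=\omega_2$, and (B) if $t\xrightarrow{\omega}$ with $\omega\in\Omega$ and $t\xrightarrow{\alpha}\Delta$ with $\alpha\in\mathsf{Act}\cup\{\tau\}$, then $u\xrightarrow{\omega}$ for all $u\in\mathrm{supp}\,\Delta$. For distributions put $(\Theta\|\Delta)(t,p)=\Theta(t)\Delta(p)$. The pLTS $\mathbf C$ of applications of tests to processes has states $T\times P$, visible actions $\Omega$, and exactly the transitions $(t,p)\xrightarrow{\alpha}\Theta'\|\overline{p}$ if $\alpha\in\Omega\cup\{\tau\}$ and $t\xrightarrow{\alpha}\Theta'$; $(t,p)\xrightarrow{\tau}\overline{t}\|\Delta'$ if $p\xrightarrow{\tau}\Delta'$; and $(t,p)\xrightarrow{\tau}\Theta'\|\Delta'$ if $t\xrightarrow{a}\Theta'$ and $p\xrightarrow{a}\Delta'$ for some $a\in\mathsf{Act}$. Resolution-based outcomes. A resolution of a subdistribution $\Gamma$ over the states of a pLTS $\langle S,\Omega,\to\rangle$ is a deterministic pLTS $\langle R,\Omega,\to_R\rangle$ with a subdistribution $\Lambda$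 over $R$ for which there is $f:R\to S$ such that $\mathrm{Img}_f(\Lambda)=\Gamma$; $r\xrightarrow{\alpha}_R\Lambda'$ implies $f(r)\xrightarrow{\alpha}\mathrm{Img}_f(\Lambda')$; and $f(r)\xrightarrow{\alpha}$ implies $r\xrightarrow{\alpha}_R$ (for all $\alpha\in\Omega\cup\{\tau\}$). Let $\mathbb V_R:R\to[0,1]^\Omega$ be the least fixed point of the monotone functional $\mathcal R$ with $\mathcal R(g)(r)(\omega)=1$ if $r\xrightarrow{\omega}_R$; $\mathcal R(g)(r)(\omega)=0$ if neither $r\xrightarrow{\omega}_R$ nor $r\xrightarrow{\tau}_R$; and $\mathcal R(g)(r)(\omega)=\mathrm{Exp}_{\Lambda'}(g)(\omega)$ if not $r\xrightarrow{\omega}_R$ and $r\xrightarrow{\tau}_R\Lambda'$. Then $\mathcal A(\Theta,\Delta)=\{\mathrm{Exp}_\Lambda(\mathbb V_R)\mid\langle R,\Lambda,\to_R\rangle\text{ is a resolution of }\Theta\|\Delta\text{ in }\mathbf C\}$. Derivation-based outcomes. Let $[\mathbf C]$ be $\mathbf C$ without the transitions $s\xrightarrow{\tau}\Delta'$ of states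 $s$ with $s\xrightarrow{\omega}$ for some $\omega\in\Omega$. Lift $\xrightarrow{\tau}$ to the smallest relation between subdistributions such that $s\xrightarrow{\tau}\Delta'$ implies $\overline{s}\xrightarrow{\tau}\Delta'$, and $\Gamma_i\xrightarrow{\tau}\Delta_i$ ($i\in I$) implies $\sum_ip_i\Gamma_i\xrightarrow{\tau}\sum_ip_i\Delta_i$ for all $p_i\in[0,1]$ with $\sum_ip_i\le1$ (any index set $I$). An extreme derivative of $\Gamma$ is a subdistribution $\Gamma'=\sum_{k\ge0}\Gamma_k^{\times}$, where $\Gamma=\Gamma_0^{\to}+\Gamma_0^{\times}$ and $\Gamma_k^{\to}\xrightarrow{\tau}\Gamma_{k+1}^{\to}+\Gamma_{k+1}^{\times}$ for all $k\ge0$ for some subdistributions $\Gamma_k^{\to},\Gamma_k^{\times}$, such that no $s\in\mathrm{supp}\,\Gamma'$ has $s\xrightarrow{\tau}$. Its outcome is $\$\Gamma'\in[0,1]^\Omega$, $\$\Gamma'(\omega)=\sum\{\Gamma'(s)\mid s\xrightarrow{\omega}\}$. Then $\mathcal A^{\mathrm d}(\Theta,\Delta)=\{\$\Lambda\mid\Lambda\text{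 is an extreme derivative of }\Theta\|\Delta\text{ in }[\mathbf C]\}$. Theorem. For any test $\Theta$ and any process $\Delta$, $\mathcal A^{\mathrm d}(\Theta,\Delta)=\mathcal A(\Theta,\Delta)$. -/

import Mathlib

open scoped ENNReal

universe u v

namespace ProbTest

/-- The unit interval `[0,1]`, as an order and with the arithmetic of `[0,∞]`. -/
abbrev Prob : Type := Set.Iic (1 : ℝ≥0∞)

/-- A discrete subdistribution over `S`: a function to `[0,1]` of total mass at most `1`.
Full distributions are Mathlib's `PMF S`. -/
@[ext]
structure SubDist (S : Type*) where
  /-- the probability that is assigned to each element -/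
  prob : S → ℝ≥0∞
  mass_le_one : ∑' s, prob s ≤ 1

namespace SubDist

variable {S R I Ω : Type*}

/-- A full distribution, seen as a subdistribution. -/
noncomputable def ofPMF (Δ : PMF S) : SubDist S := ⟨Δ, Δ.tsum_coe.le⟩

/-- The point (sub)distribution at `s`. -/
noncomputable def point (s : S) : SubDist S := ofPMF (PMF.pure s)

open Classical in
/-- The image of a subdistribution under `f : R → S`. -/
noncomputable def map (f : R → S) (Λ : SubDist R) : SubDist S where
  prob s := ∑' r, if f r = s then Λ.prob r else 0
  mass_le_one := by
    rw [ENNReal.tsum_comm]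
    simpa [eq_comm] using Λ.mass_le_one

/-- The subdistribution `∑ i, p i • Δ i`, where `∑ i, p i ≤ 1`. -/
noncomputable def mix (p : I → ℝ≥0∞) (hp : ∑' i, p i ≤ 1) (Δ : I → SubDist S) : SubDist S where
  prob s := ∑' i, p i * (Δ i).prob s
  mass_le_one := by
    rw [ENNReal.tsum_comm]
    refine le_trans (ENNReal.tsum_le_tsum fun i => ?_) hp
    rw [ENNReal.tsum_mul_left]
    exact mul_le_of_le_one_right' (Δ i).mass_le_one

/-- The expected value of `f : S → [0,1]^Ω` over the subdistribution `Δ`. -/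
noncomputable def expect (Δ : SubDist S) (f : S → Ω → Prob) : Ω → Prob := fun ω =>
  ⟨∑' s, Δ.prob s * (f s ω : ℝ≥0∞),
    le_trans (ENNReal.tsum_le_tsum fun s => mul_le_of_le_one_right' (f s ω).2) Δ.mass_le_one⟩

end SubDist

/-- Transition labels: the visible actions, and the internal action `τ`. -/
inductive Label (Act : Type*) where
  | tau : Label Act
  | act (a : Act) : Label Act

/-- A probabilistic labelled transition system with states `S` and visible actions `Act`;
transitions lead from states to full distributions. -/
structure PLTS (S : Type*) (Act : Type*) where
  /-- `trans s α Δ` is the transition from `s` to `Δ` labelled `α` -/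
  trans : S → Label Act → PMF S → Prop

namespace PLTS

variable {S R T P Act Ω : Type*}

/-- Some `α`-transition leaves `s`. -/
def Can (L : PLTS S Act) (s : S) (α : Label Act) : Prop := ∃ Δ, L.trans s α Δ

/-- At most one transition for each state and label. -/
def Deterministic (L : PLTS S Act) : Prop :=
  ∀ s α Δ Δ', L.trans s α Δ → L.trans s α Δ' → Δ = Δ'

/-- The two requirements on a pLTS of tests, whose visible actions are the disjoint union of the
visible actions `Act` of processes and the success actions `Ω`: a state has at most one success
action, and a success action stays enabled along all other transitions. -/
structure IsTest (L : PLTS T (Act ⊕ Ω)) : Prop where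
  unique : ∀ t ω₁ ω₂, L.Can t (.act (.inr ω₁)) → L.Can t (.act (.inr ω₂)) → ω₁ = ω₂
  persist_tau : ∀ t ω Δ, L.Can t (.act (.inr ω)) → L.trans t .tau Δ →
    ∀ u ∈ Δ.support, L.Can u (.act (.inr ω))
  persist_act : ∀ t ω a Δ, L.Can t (.act (.inr ω)) → L.trans t (.act (.inl a)) Δ →
    ∀ u ∈ Δ.support, L.Can u (.act (.inr ω))

end PLTS

/-- The distribution `Θ ‖ Δ`, given by `(Θ ‖ Δ)(t ‖ p) = Θ(t) · Δ(p)`. -/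
noncomputable def parDist {T P : Type*} (Θ : PMF T) (Δ : PMF P) : PMF (T × P) :=
  ⟨fun c => Θ c.1 * Δ c.2, by
    have h : ∑' c : T × P, Θ c.1 * Δ c.2 = 1 := by
      rw [ENNReal.tsum_prod (f := fun t p => Θ t * Δ p)]
      simp [ENNReal.tsum_mul_left, PMF.tsum_coe]
    exact h ▸ ENNReal.summable.hasSum⟩

/-- Transitions of the application of tests to processes: all visible actions of the process
synchronise with the test and become `τ`; `τ`-steps interleave; the success actions of the test
remain visible. -/
inductive ParTrans {T P Act Ω : Type*} (LT : PLTS T (Act ⊕ Ω)) (LP : PLTS P Act) :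
    T × P → Label Ω → PMF (T × P) → Prop
  | left_tau (t : T) (p : P) (Θ : PMF T) : LT.trans t .tau Θ →
      ParTrans LT LP (t, p) .tau (parDist Θ (PMF.pure p))
  | left_success (t : T) (p : P) (ω : Ω) (Θ : PMF T) : LT.trans t (.act (.inr ω)) Θ →
      ParTrans LT LP (t, p) (.act ω) (parDist Θ (PMF.pure p))
  | right_tau (t : T) (p : P) (Δ : PMF P) : LP.trans p .tau Δ →
      ParTrans LT LP (t, p) .tau (parDist (PMF.pure t) Δ)
  | sync (t : T) (p : P) (a : Act) (Θ : PMF T) (Δ : PMF P) :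
      LT.trans t (.act (.inl a)) Θ → LP.trans p (.act a) Δ →
      ParTrans LT LP (t, p) .tau (parDist Θ Δ)

/-- The pLTS of applications of tests to processes. -/
def par {T P Act Ω : Type*} (LT : PLTS T (Act ⊕ Ω)) (LP : PLTS P Act) : PLTS (T × P) Ω :=
  ⟨ParTrans LT LP⟩

/-! ### Resolutions -/

/-- `⟨R, Λ, →⟩`, with `K = ⟨R, Ω, →⟩`, is a resolution of `Δ` in `L`. -/
def IsResolution {S R Ω : Type*} (L : PLTS S Ω) (Δ : SubDist S) (K : PLTS R Ω)
    (Λ : SubDist R) : Prop :=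
  K.Deterministic ∧ ∃ f : R → S,
    Λ.map f = Δ ∧
    (∀ r α (Λ' : PMF R), K.trans r α Λ' → L.trans (f r) α (Λ'.map f)) ∧
    (∀ r α, L.Can (f r) α → K.Can r α)

open Classical in
/-- The functional whose least fixed point is the evaluation function of a deterministic pLTS. -/
noncomputable def evalStep {R Ω : Type*} (K : PLTS R Ω) (g : R → Ω → Prob) : R → Ω → Prob :=
  fun r ω =>
    if K.Can r (.act ω) then ⟨1, Set.mem_Iic.2 le_rfl⟩
    else if h : K.Can r .tau then (SubDist.ofPMF h.choose).expect g ω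
    else ⟨0, Set.mem_Iic.2 zero_le_one⟩

theorem evalStep_mono {R Ω : Type*} (K : PLTS R Ω) : Monotone (evalStep K) := by
  intro g g' h r ω
  unfold evalStep
  split_ifs
  · exact le_rfl
  · refine Subtype.mk_le_mk.2 (ENNReal.tsum_le_tsum fun s => ?_)
    have hs : (g s ω : ℝ≥0∞) ≤ g' s ω := h s ω
    gcongr
  · exact le_rfl

/-- The evaluation function `𝕍` of a deterministic pLTS: the least fixed point of `evalStep` in the
complete lattice of functions `R → [0,1]^Ω`. -/
noncomputable def eval {R Ω : Type*} (K : PLTS R Ω) : R → Ω → Prob :=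
  OrderHom.lfp ⟨evalStep K, evalStep_mono K⟩

/-- The resolution-based outcome set `𝒜(Θ, Δ)`. -/
def resolutionOutcomes {T : Type u} {P : Type v} {Act Ω : Type*} (LT : PLTS T (Act ⊕ Ω))
    (LP : PLTS P Act) (Θ : PMF T) (Δ : PMF P) : Set (Ω → Prob) :=
  {o | ∃ (R : Type (max u v)) (K : PLTS R Ω) (Λ : SubDist R),
    IsResolution (par LT LP) (SubDist.ofPMF (parDist Θ Δ)) K Λ ∧ o = Λ.expect (eval K)}

/-! ### Derivations -/

/-- The lifting of a relation between states and subdistributions: the smallest relation between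
subdistributions that contains it at point distributions and is linear. (As at most countably many
of the `p i` are nonzero, index types in `Type` are enough.) -/
inductive Lift {S : Type*} (Rel : S → SubDist S → Prop) : SubDist S → SubDist S → Prop
  | base (s : S) (Δ : SubDist S) : Rel s Δ → Lift Rel (SubDist.point s) Δ
  | linear (I : Type) (p : I → ℝ≥0∞) (hp : ∑' i, p i ≤ 1) (Γ Δ : I → SubDist S) :
      (∀ i, Lift Rel (Γ i) (Δ i)) → Lift Rel (SubDist.mix p hp Γ) (SubDist.mix p hp Δ)

namespace PLTS

variable {S Act Ω : Type*}

/-- The lifted `α`-transition relation between subdistributions. -/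
def Step (L : PLTS S Act) (α : Label Act) : SubDist S → SubDist S → Prop :=
  Lift fun s Γ => ∃ Δ : PMF S, L.trans s α Δ ∧ Γ = SubDist.ofPMF Δ

/-- `Δ'` is a weak derivative of `Δ`; `go k` and `halt k` are the parts of the `k`-th stage that
move on and that stop. -/
def WeakDer (L : PLTS S Act) (Δ Δ' : SubDist S) : Prop :=
  ∃ go halt : ℕ → SubDist S,
    (∀ s, Δ.prob s = (go 0).prob s + (halt 0).prob s) ∧
    (∀ k, ∃ Γ : SubDist S, L.Step .tau (go k) Γ ∧
      ∀ s, Γ.prob s = (go (k + 1)).prob s + (halt (k + 1)).prob s) ∧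
    ∀ s, Δ'.prob s = ∑' k, (halt k).prob s

/-- No state in the support of `Δ` has a `τ`-transition. -/
def Stable (L : PLTS S Act) (Δ : SubDist S) : Prop :=
  ∀ s, Δ.prob s ≠ 0 → ¬ L.Can s .tau

/-- `Δ'` is an extreme derivative of `Δ`. -/
def ExtremeDer (L : PLTS S Act) (Δ Δ' : SubDist S) : Prop :=
  L.WeakDer Δ Δ' ∧ L.Stable Δ'

/-- Pruning: remove all `τ`-transitions of success states. -/
def prune (L : PLTS S Ω) : PLTS S Ω :=
  ⟨fun s α Δ => L.trans s α Δ ∧ ¬ (α = .tau ∧ ∃ ω, L.Can s (.act ω))⟩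

open Classical in
/-- The outcome of a (stable) subdistribution: its `ω`-component is the mass of the states that
enable `ω`. -/
noncomputable def outcome (L : PLTS S Ω) (Δ : SubDist S) : Ω → Prob := fun ω =>
  ⟨∑' s, if L.Can s (.act ω) then Δ.prob s else 0,
    le_trans (ENNReal.tsum_le_tsum fun s => by split_ifs <;> simp) Δ.mass_le_one⟩

end PLTS

/-- The derivation-based outcome set `𝒜ᵈ(Θ, Δ)`: the outcomes of the extreme derivatives of `Θ ‖ Δ`
in the pruned pLTS of applications of tests to processes. -/
def derivationOutcomes {T P Act Ω : Type*} (LT : PLTS T (Act ⊕ Ω)) (LP : PLTS P Act)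
    (Θ : PMF T) (Δ : PMF P) : Set (Ω → Prob) :=
  {o | ∃ Λ : SubDist (T × P),
    (par LT LP).prune.ExtremeDer (SubDist.ofPMF (parDist Θ Δ)) Λ ∧
      o = (par LT LP).prune.outcome Λ}

end ProbTest

/-! In a deterministic pLTS whose success actions are unique and persist along `τ`, every extreme
derivative of `Λ` after pruning has outcome `Λ.expect (eval K)` (`PLTS.ExtremeDer.expect_eval`): the
`n`-th iterate towards the least fixed point counts exactly the success mass that halts in the first
`n` stages. Pruning costs nothing, since beyond a success state no other success action can occur.

It remains to move between a pLTS and its resolutions. From a resolution, an extreme derivative of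
the pruned deterministic system exists (`PLTS.exists_extremeDer`) and projects to one of the
original, with the same outcome. Conversely, a derivation may split the mass at a state among
several transitions, differently at each stage. `PLTS.ExtremeDer.exists_unfold` makes it
deterministic by storing in each state the stage and the transition to be taken next, so that the
choice becomes part of the preceding random draw. -/

theorem ENNReal.tsum_iSup_of_monotone {α : Type*} {f : ℕ → α → ℝ≥0∞} (hf : Monotone f) :
    ∑' a, ⨆ n, f n a = ⨆ n, ∑' a, f n a := by
  let _ : MeasurableSpace α := ⊤
  simpa only [MeasureTheory.lintegral_count] using
    MeasureTheory.lintegral_iSup (μ := MeasureTheory.Measure.count)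
      (fun n => measurable_from_top (f := f n)) hf

namespace ProbTest

/-! ### Calculus of subdistributions: images, mixtures, kernels -/

namespace SubDist

variable {S R I Ω : Type*}

theorem point_prob [DecidableEq S] (s x : S) : (point s).prob x = if x = s then 1 else 0 := by
  simp [point, ofPMF, PMF.pure_apply]

theorem tsum_point_mul (s : S) (g : S → ℝ≥0∞) : ∑' x, (point s).prob x * g x = g s := by
  classical
  rw [tsum_eq_single s]
  · simp [point_prob]
  · intro x hx
    simp [point_prob, hx]

theorem tsum_mix_mul (p : I → ℝ≥0∞) (hp : ∑' i, p i ≤ 1) (Δ : I → SubDist S) (g : S → ℝ≥0∞) :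
    ∑' s, (mix p hp Δ).prob s * g s = ∑' i, p i * ∑' s, (Δ i).prob s * g s := by
  simp only [mix, ← ENNReal.tsum_mul_right, ← ENNReal.tsum_mul_left]
  rw [ENNReal.tsum_comm]
  simp only [mul_assoc]

theorem tsum_map_mul (f : R → S) (Λ : SubDist R) (g : S → ℝ≥0∞) :
    ∑' s, (Λ.map f).prob s * g s = ∑' r, Λ.prob r * g (f r) := by
  classical
  simp only [map, ← ENNReal.tsum_mul_right]
  rw [ENNReal.tsum_comm]
  refine tsum_congr fun r => ?_
  rw [tsum_eq_single (f r)]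
  · simp
  · intro s hs
    simp [hs.symm]

theorem map_prob_ne_zero (f : R → S) (Λ : SubDist R) (s : S) (h : (Λ.map f).prob s ≠ 0) :
    ∃ r, f r = s ∧ Λ.prob r ≠ 0 := by
  obtain ⟨r, hr⟩ := (ENNReal.summable.tsum_ne_zero_iff).1 h
  exact ⟨r, by simpa using hr⟩

theorem prob_ne_zero_map (f : R → S) (Λ : SubDist R) (r : R) (h : Λ.prob r ≠ 0) :
    (Λ.map f).prob (f r) ≠ 0 := by
  refine (ENNReal.summable.tsum_ne_zero_iff).2 ⟨r, ?_⟩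
  simpa using h

theorem map_point (f : R → S) (r : R) : (point r).map f = point (f r) := by
  classical
  ext s
  simp only [map]
  rw [tsum_eq_single r]
  · simp [point_prob, eq_comm]
  · intro x hx
    simp [point_prob, hx]

theorem map_ofPMF (f : R → S) (Δ : PMF R) : (ofPMF Δ).map f = ofPMF (Δ.map f) := by
  ext s
  simp only [map, ofPMF, PMF.map_apply]
  refine tsum_congr fun r => ?_
  rcases eq_or_ne (f r) s with rfl | h
  · simp
  · simp [h, h.symm]

theorem map_mix (f : R → S) (p : I → ℝ≥0∞) (hp : ∑' i, p i ≤ 1) (Δ : I → SubDist R) :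
    (mix p hp Δ).map f = mix p hp fun i => (Δ i).map f := by
  ext s
  simp only [map, mix, ← ENNReal.tsum_mul_left]
  rw [ENNReal.tsum_comm]
  refine tsum_congr fun r => ?_
  split_ifs <;> simp

theorem map_add (f : R → S) {Λ Λ₁ Λ₂ : SubDist R}
    (h : ∀ r, Λ.prob r = Λ₁.prob r + Λ₂.prob r) (s : S) :
    (Λ.map f).prob s = (Λ₁.map f).prob s + (Λ₂.map f).prob s := by
  simp only [map, ← ENNReal.tsum_add]
  refine tsum_congr fun r => ?_
  split_ifs <;> simp [h]

theorem map_tsum (f : R → S) {Λ : SubDist R} {Λ' : I → SubDist R}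
    (h : ∀ r, Λ.prob r = ∑' i, (Λ' i).prob r) (s : S) :
    (Λ.map f).prob s = ∑' i, ((Λ' i).map f).prob s := by
  simp only [map]
  rw [ENNReal.tsum_comm]
  refine tsum_congr fun r => ?_
  split_ifs <;> simp [h]

/-- The subdistribution that draws `s` from `Λ` and then an element from `κ s`. -/
noncomputable def bind (Λ : SubDist S) (κ : S → PMF R) : SubDist R where
  prob r := ∑' s, Λ.prob s * κ s r
  mass_le_one := by
    rw [ENNReal.tsum_comm]
    simpa [ENNReal.tsum_mul_left, PMF.tsum_coe] using Λ.mass_le_one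

theorem mass_bind (Λ : SubDist S) (κ : S → PMF R) :
    ∑' r, (Λ.bind κ).prob r = ∑' s, Λ.prob s := by
  simp only [bind]
  rw [ENNReal.tsum_comm]
  simp [ENNReal.tsum_mul_left, PMF.tsum_coe]

open Classical in
/-- The part of a subdistribution that lies in a set of states. -/
noncomputable def restrict (Λ : SubDist S) (A : Set S) : SubDist S where
  prob s := if s ∈ A then Λ.prob s else 0
  mass_le_one :=
    le_trans (ENNReal.tsum_le_tsum fun s => by split_ifs <;> simp) Λ.mass_le_one

theorem restrict_add_compl (Λ : SubDist S) (A : Set S) (s : S) :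
    Λ.prob s = (Λ.restrict A).prob s + (Λ.restrict Aᶜ).prob s := by
  by_cases h : s ∈ A <;> simp [restrict, h]

end SubDist

open SubDist

variable {S R Ω : Type*}

/-! ### Lifted transitions as randomised choices of transitions -/

/-- `w s D` is the mass that leaves `s` by its transition to `D`; such weights are evident at point
distributions and combine linearly. -/
theorem Lift.exists_weights {Rel : S → PMF S → Prop} {go Γ : SubDist S}
    (h : Lift (fun s Γ => ∃ Δ : PMF S, Rel s Δ ∧ Γ = ofPMF Δ) go Γ) :
    ∃ w : S → PMF S → ℝ≥0∞, (∀ s D, w s D ≠ 0 → Rel s D) ∧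
      (∀ s, go.prob s = ∑' D, w s D) ∧ ∀ x, Γ.prob x = ∑' s, ∑' D, w s D * D x := by
  classical
  induction h with
  | base s Γ h =>
    obtain ⟨Δ, hΔ, rfl⟩ := h
    refine ⟨fun x D => if x = s then (if D = Δ then 1 else 0) else 0, ?_, ?_, ?_⟩
    · intro x D h
      simp only [ne_eq, ite_eq_right_iff, one_ne_zero, imp_false, not_forall, not_not] at h
      obtain ⟨rfl, rfl⟩ := h
      exact hΔ
    · intro x
      by_cases hx : x = s <;> simp [point_prob, hx]
    · intro x
      rw [tsum_eq_single s, tsum_eq_single Δ]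
      · simp [ofPMF]
      · intro D hD
        simp [hD]
      · intro y hy
        simp [hy]
  | linear I p hp Γ Δ _ ih =>
    choose w hw hgo hΓ using ih
    refine ⟨fun s D => ∑' i, p i * w i s D, ?_, ?_, ?_⟩
    · intro s D h
      obtain ⟨i, hi⟩ := (ENNReal.summable.tsum_ne_zero_iff).1 h
      exact hw i s D (right_ne_zero_of_mul hi)
    · intro s
      rw [ENNReal.tsum_comm]
      simp only [mix, hgo, ENNReal.tsum_mul_left]
    · intro x
      simp only [mix, hΓ, ← ENNReal.tsum_mul_left, ← ENNReal.tsum_mul_right]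
      rw [ENNReal.tsum_comm]
      refine tsum_congr fun s => ?_
      rw [ENNReal.tsum_comm]
      simp only [mul_assoc]

theorem Lift.exists_kernel {Rel : S → PMF S → Prop} {go Γ : SubDist S}
    (h : Lift (fun s Γ => ∃ Δ : PMF S, Rel s Δ ∧ Γ = ofPMF Δ) go Γ) :
    ∃ κ : S → PMF (PMF S), (∀ s D, go.prob s ≠ 0 → κ s D ≠ 0 → Rel s D) ∧
      ∀ x, Γ.prob x = ∑' s, ∑' D, go.prob s * κ s D * D x := by
  obtain ⟨w, hw, hgo, hΓ⟩ := h.exists_weights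
  have hκ : ∀ s, ∃ q : PMF (PMF S), ∀ D, w s D = go.prob s * q D := by
    intro s
    have htop : go.prob s ≠ ∞ :=
      ((ENNReal.le_tsum s).trans go.mass_le_one).trans_lt ENNReal.one_lt_top |>.ne
    by_cases h0 : go.prob s = 0
    -- No mass moves from `s`, so any distribution serves here.
    · refine ⟨PMF.pure (PMF.pure s), fun D => ?_⟩
      rw [h0, zero_mul]
      exact ENNReal.tsum_eq_zero.1 ((hgo s).symm.trans h0) D
    · refine ⟨PMF.normalize (w s) (hgo s ▸ h0) (hgo s ▸ htop), fun D => ?_⟩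
      rw [PMF.normalize_apply, ← hgo s, mul_left_comm, ENNReal.mul_inv_cancel h0 htop, mul_one]
  choose κ hκ using hκ
  refine ⟨κ, fun s D h1 h2 => hw s D ?_, fun x => ?_⟩
  · rw [hκ]
    exact mul_ne_zero h1 h2
  · rw [hΓ]
    simp only [hκ]

theorem Lift.bind {Rel : S → PMF S → Prop} (go : SubDist S) (succ : S → PMF S)
    (h : ∀ s, go.prob s ≠ 0 → Rel s (succ s)) :
    Lift (fun s Γ => ∃ Δ : PMF S, Rel s Δ ∧ Γ = ofPMF Δ) go (go.bind succ) := by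
  classical
  have hc : (Function.support go.prob).Countable :=
    Summable.countable_support_ennreal (go.mass_le_one.trans_lt ENNReal.one_lt_top).ne
  have : Countable (Function.support go.prob) := hc
  -- The countable support is copied into `Type`, the universe of the index types in `Lift.linear`.
  let e := equivShrink.{0} (Function.support go.prob)
  have key : ∀ g : S → ℝ≥0∞, ∑' i, go.prob (e.symm i) * g (e.symm i) = ∑' s, go.prob s * g s := by
    intro g
    rw [e.symm.tsum_eq (fun s : Function.support go.prob => go.prob s * g s)]
    refine tsum_subtype_eq_of_support_subset (f := fun s => go.prob s * g s) fun s hs => ?_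
    exact left_ne_zero_of_mul hs
  have hp : ∑' i, go.prob (e.symm i) ≤ 1 := by
    simpa using (key fun _ => 1).le.trans (by simpa using go.mass_le_one)
  have := Lift.linear (Rel := fun s Γ => ∃ Δ : PMF S, Rel s Δ ∧ Γ = ofPMF Δ) _
    (fun i => go.prob (e.symm i)) hp (fun i => point (e.symm i : S))
    (fun i => ofPMF (succ (e.symm i))) fun i => .base _ _ ⟨_, h _ (e.symm i).2, rfl⟩
  convert this using 1
  · ext s
    refine Eq.trans ?_ (key fun x => (point x).prob s).symm
    rw [tsum_eq_single s]
    · simp [point_prob]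
    · intro x hx
      simp [point_prob, hx.symm]
  · ext s
    exact (key fun x => succ x s).symm

theorem Lift.map {Rel : R → SubDist R → Prop} {Rel' : S → SubDist S → Prop} (f : R → S)
    (hRel : ∀ r Γ, Rel r Γ → Rel' (f r) (Γ.map f)) {Λ Γ : SubDist R} (h : Lift Rel Λ Γ) :
    Lift Rel' (Λ.map f) (Γ.map f) := by
  induction h with
  | base r Γ h =>
    rw [map_point]
    exact .base _ _ (hRel _ _ h)
  | linear I p hp Γ Δ _ ih =>
    rw [map_mix, map_mix]
    exact .linear I p hp _ _ ih

/-! ### Projection along resolutions, and existence of extreme derivatives -/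

namespace PLTS

/-- A state has at most one success action, and success actions stay enabled along internal
transitions. -/
structure SuccessPersistent (L : PLTS S Ω) : Prop where
  unique : ∀ s ω₁ ω₂, L.Can s (.act ω₁) → L.Can s (.act ω₂) → ω₁ = ω₂
  persist : ∀ s ω Δ, L.Can s (.act ω) → L.trans s .tau Δ → ∀ u ∈ Δ.support, L.Can u (.act ω)

/-- Every transition of `K` projects along `f` to one of `L`, and `K` enables every label that `L`
enables. -/
structure Resolves (K : PLTS R Ω) (L : PLTS S Ω) (f : R → S) : Prop where
  trans : ∀ r α (Λ : PMF R), K.trans r α Λ → L.trans (f r) α (Λ.map f)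
  can : ∀ r α, L.Can (f r) α → K.Can r α

theorem prune_can_act (L : PLTS S Ω) (s : S) (ω : Ω) :
    L.prune.Can s (.act ω) ↔ L.Can s (.act ω) := by
  simp [Can, prune]

theorem prune_can_tau (L : PLTS S Ω) (s : S) :
    L.prune.Can s .tau ↔ L.Can s .tau ∧ ¬ ∃ ω, L.Can s (.act ω) := by
  simp [Can, prune]

namespace Resolves

variable {K : PLTS R Ω} {L : PLTS S Ω} {f : R → S}

theorem can_iff (h : K.Resolves L f) (r : R) (α : Label Ω) : L.Can (f r) α ↔ K.Can r α :=
  ⟨h.can r α, fun ⟨Λ, hΛ⟩ => ⟨_, h.trans r α Λ hΛ⟩⟩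

/-- A state and its projection enable the same labels, so pruning affects both alike. -/
protected theorem prune (h : K.Resolves L f) : K.prune.Resolves L.prune f where
  trans r α Λ hΛ := ⟨h.trans r α Λ hΛ.1, by simpa only [h.can_iff] using hΛ.2⟩
  can r α := by
    rintro ⟨Δ, hΔ, hn⟩
    obtain ⟨Λ, hΛ⟩ := h.can r α ⟨Δ, hΔ⟩
    exact ⟨Λ, hΛ, by simpa only [h.can_iff] using hn⟩

theorem successPersistent (h : K.Resolves L f) (hL : L.SuccessPersistent) :
    K.SuccessPersistent where
  unique r ω₁ ω₂ h₁ h₂ := hL.unique (f r) ω₁ ω₂ ((h.can_iff _ _).2 h₁) ((h.can_iff _ _).2 h₂)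
  persist r ω Λ hr hΛ u hu := by
    refine h.can _ _ (hL.persist (f r) ω _ ((h.can_iff _ _).2 hr) (h.trans _ _ _ hΛ) (f u) ?_)
    rw [PMF.support_map]
    exact ⟨u, hu, rfl⟩

theorem step (h : K.Resolves L f) {α : Label Ω} {Λ Γ : SubDist R} (hs : K.Step α Λ Γ) :
    L.Step α (Λ.map f) (Γ.map f) :=
  hs.map f fun r _ ⟨Λ', hΛ', e⟩ => ⟨Λ'.map f, h.trans r α Λ' hΛ', by rw [e, map_ofPMF]⟩

theorem extremeDer (h : K.Resolves L f) {Λ Λ' : SubDist R} (hd : K.ExtremeDer Λ Λ') :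
    L.ExtremeDer (Λ.map f) (Λ'.map f) := by
  obtain ⟨⟨go, halt, h₀, hk, hs⟩, hst⟩ := hd
  refine ⟨⟨fun k => (go k).map f, fun k => (halt k).map f, map_add f h₀, fun k => ?_,
    map_tsum f hs⟩, fun s hs' hc => ?_⟩
  · obtain ⟨Γ, hΓ, e⟩ := hk k
    exact ⟨Γ.map f, h.step hΓ, map_add f e⟩
  · obtain ⟨r, rfl, hr⟩ := map_prob_ne_zero f Λ' s hs'
    exact hst r hr (h.can _ _ hc)

theorem outcome_map (h : K.Resolves L f) (Λ : SubDist R) :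
    L.outcome (Λ.map f) = K.outcome Λ := by
  classical
  ext ω
  simpa [outcome, h.can_iff] using
    tsum_map_mul f Λ fun s => if L.Can s (.act ω) then 1 else 0

end Resolves

/-- Fix one `τ`-successor for each state that has one, let mass move whenever it can, and collect
what stops. -/
theorem exists_extremeDer (L : PLTS S Ω) (Λ : SubDist S) : ∃ Λ', L.ExtremeDer Λ Λ' := by
  classical
  let A : Set S := {s | L.Can s .tau}
  have hsucc : ∀ s, ∃ Δ : PMF S, s ∈ A → L.trans s .tau Δ := fun s => by
    by_cases h : s ∈ A
    · exact ⟨h.choose, fun _ => h.choose_spec⟩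
    · exact ⟨PMF.pure s, fun h' => (h h').elim⟩
  choose succ hsucc using hsucc
  let flow : ℕ → SubDist S := fun k => k.rec Λ fun _ Γ => (Γ.restrict A).bind succ
  -- Mass is conserved: what has halted before stage `n` plus what is present at stage `n` is the
  -- initial mass. This bounds the mass of the limit.
  have hmass : ∀ n, ∑ k ∈ Finset.range n, ∑' s, ((flow k).restrict Aᶜ).prob s +
      ∑' s, (flow n).prob s = ∑' s, Λ.prob s := by
    intro n
    induction n with
    | zero => simp [flow]
    | succ n ih =>
      have h₁ : ∑' s, (flow (n + 1)).prob s = ∑' s, ((flow n).restrict A).prob s :=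
        mass_bind _ _
      have h₂ : ∑' s, (flow n).prob s =
          ∑' s, ((flow n).restrict A).prob s + ∑' s, ((flow n).restrict Aᶜ).prob s := by
        rw [← ENNReal.tsum_add]
        exact tsum_congr fun s => restrict_add_compl _ _ _
      rw [← ih, Finset.sum_range_succ, h₁, h₂, add_assoc, add_comm (∑' s, _) (∑' s, _)]
  refine ⟨⟨fun s => ∑' k, ((flow k).restrict Aᶜ).prob s, ?_⟩,
    ⟨fun k => (flow k).restrict A, fun k => (flow k).restrict Aᶜ, restrict_add_compl _ _,
      fun k => ⟨flow (k + 1), Lift.bind _ _ fun s hs => hsucc s ?_, restrict_add_compl _ _⟩,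
      fun s => rfl⟩, fun s hs hc => hs ?_⟩
  · rw [ENNReal.tsum_comm, ENNReal.tsum_eq_iSup_nat]
    exact iSup_le fun n => (le_self_add.trans (hmass n).le).trans Λ.mass_le_one
  · by_contra h
    simp [restrict, h] at hs
  · have : s ∈ A := hc
    simp [restrict, this]

end PLTS

/-! ### Evaluation by iteration, and its agreement with extreme derivatives -/

/-- The `n`-th iterate of `evalStep` from below. -/
noncomputable def approx (K : PLTS S Ω) : ℕ → S → Ω → Prob
  | 0 => ⊥
  | n + 1 => evalStep K (approx K n)

theorem approx_zero_coe (K : PLTS S Ω) (s : S) (ω : Ω) : (approx K 0 s ω : ℝ≥0∞) = 0 := rfl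

theorem approx_mono (K : PLTS S Ω) : Monotone (approx K) := by
  refine monotone_nat_of_le_succ fun n => ?_
  induction n with
  | zero => exact bot_le
  | succ n ih => exact evalStep_mono K ih

theorem expect_iSup (Λ : SubDist S) {g : ℕ → S → Ω → Prob} (hg : Monotone g) (ω : Ω) :
    (Λ.expect (⨆ n, g n) ω : ℝ≥0∞) = ⨆ n, (Λ.expect (g n) ω : ℝ≥0∞) := by
  simp only [expect, iSup_apply, Set.Iic.coe_iSup, ENNReal.mul_iSup]
  refine ENNReal.tsum_iSup_of_monotone (f := fun n s => Λ.prob s * (g n s ω : ℝ≥0∞))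
    fun m n h s => ?_
  have : (g m s ω : ℝ≥0∞) ≤ g n s ω := hg h s ω
  dsimp only
  gcongr

/-- Expectation commutes with increasing suprema by monotone convergence, so the iteration closes at
`ω`. -/
theorem eval_eq_iSup_approx (K : PLTS S Ω) : eval K = ⨆ n, approx K n := by
  apply le_antisymm
  · refine OrderHom.lfp_le _ fun s ω => ?_
    change evalStep K (⨆ n, approx K n) s ω ≤ _
    have hle : ∀ n, approx K (n + 1) s ω ≤ (⨆ n, approx K n) s ω := fun n =>
      le_iSup (approx K) (n + 1) s ω
    simp only [approx] at hle
    unfold evalStep at hle ⊢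
    split_ifs at hle ⊢ with h₁ h₂
    · exact hle 0
    · rw [← Subtype.coe_le_coe, expect_iSup _ (approx_mono K)]
      exact iSup_le hle
    · exact hle 0
  · refine iSup_le fun n => ?_
    induction n with
    | zero => exact bot_le
    | succ n ih =>
      have h := evalStep_mono K ih
      exact h.trans (OrderHom.map_lfp ⟨evalStep K, evalStep_mono K⟩).le

theorem expect_coe (Λ : SubDist S) (g : S → Ω → Prob) (ω : Ω) :
    (Λ.expect g ω : ℝ≥0∞) = ∑' s, Λ.prob s * (g s ω : ℝ≥0∞) := rfl

namespace PLTS.SuccessPersistent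

variable {K : PLTS S Ω}

/-- Every `τ`-step keeps `ω'` enabled, and uniqueness then excludes `ω` in each state reached. This
is why pruning does not change values. -/
theorem approx_eq_zero (hK : K.SuccessPersistent) {s : S} {ω ω' : Ω}
    (hs : K.Can s (.act ω')) (hω : ω' ≠ ω) (n : ℕ) : (approx K n s ω : ℝ≥0∞) = 0 := by
  induction n generalizing s with
  | zero => rfl
  | succ n ih =>
    have h₁ : ¬ K.Can s (.act ω) := fun h => hω (hK.unique s _ _ hs h)
    simp only [approx, evalStep, h₁, if_false]
    split_ifs with h₂
    · refine ENNReal.tsum_eq_zero.2 fun u => ?_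
      by_cases hu : h₂.choose u = 0
      · simp [ofPMF, hu]
      · rw [ih (hK.persist s ω' _ hs h₂.choose_spec u hu), mul_zero]
    · rfl

open Classical in
-- A state that is stable after pruning either has no `τ`-step or enables a success action; in the
-- latter case the other components vanish by persistence. One iteration is needed because `approx K
-- 0` is zero even at success states.
theorem approx_succ_of_not_can (hK : K.SuccessPersistent) {s : S} (hs : ¬ K.prune.Can s .tau)
    (n : ℕ) (ω : Ω) :
    (approx K (n + 1) s ω : ℝ≥0∞) = if K.prune.Can s (.act ω) then 1 else 0 := by
  rw [prune_can_tau, not_and_not_right] at hs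
  simp only [prune_can_act]
  by_cases h₁ : K.Can s (.act ω)
  · simp [approx, evalStep, h₁]
  · rw [if_neg h₁]
    by_cases h₂ : K.Can s .tau
    · obtain ⟨ω', h'⟩ := hs h₂
      exact hK.approx_eq_zero h' (by rintro rfl; exact h₁ h') _
    · simp [approx, evalStep, h₁, h₂]

end PLTS.SuccessPersistent

/-- A state that can move after pruning enables no success action, so `evalStep` takes the
expectation over its successor, which determinism makes the given one. -/
theorem PLTS.Step.tsum_approx_succ {K : PLTS S Ω} (hK : K.Deterministic) {Λ Γ : SubDist S}
    (h : K.prune.Step .tau Λ Γ) (n : ℕ) (ω : Ω) :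
    ∑' s, Λ.prob s * (approx K (n + 1) s ω : ℝ≥0∞) = ∑' s, Γ.prob s * (approx K n s ω : ℝ≥0∞) := by
  induction h with
  | base s Γ h =>
    obtain ⟨Δ, ⟨hΔ, hn⟩, rfl⟩ := h
    have h₁ : ¬ K.Can s (.act ω) := fun h => hn ⟨rfl, ω, h⟩
    have h₂ : K.Can s .tau := ⟨Δ, hΔ⟩
    rw [tsum_point_mul]
    simp only [approx, evalStep, h₁, if_false, h₂, dif_pos]
    rw [hK _ _ _ _ h₂.choose_spec hΔ]
    rfl
  | linear I p hp Γ Δ _ ih =>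
    rw [tsum_mix_mul, tsum_mix_mul]
    simp only [ih]

theorem PLTS.ExtremeDer.expect_eval {K : PLTS S Ω} (hK : K.Deterministic)
    (hK' : K.SuccessPersistent) {Λ Λ' : SubDist S} (h : K.prune.ExtremeDer Λ Λ') :
    Λ.expect (eval K) = K.prune.outcome Λ' := by
  classical
  obtain ⟨⟨go, halt, h₀, hk, hs⟩, hst⟩ := h
  have hhalt : ∀ k s, (halt k).prob s ≠ 0 → ¬ K.prune.Can s .tau := fun k s h =>
    hst s (hs s ▸ (ENNReal.summable.tsum_ne_zero_iff).2 ⟨k, h⟩)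
  ext ω
  -- `F k n` is the value of the whole `k`-th stage under `n` iterations; `H k` is the `ω`-success
  -- mass that halts there.
  let F : ℕ → ℕ → ℝ≥0∞ := fun k n =>
    ∑' s, ((go k).prob s + (halt k).prob s) * (approx K n s ω : ℝ≥0∞)
  let H : ℕ → ℝ≥0∞ := fun k => ∑' s, if K.prune.Can s (.act ω) then (halt k).prob s else 0
  have hF : ∀ k n, F k (n + 1) = H k + F (k + 1) n := by
    intro k n
    obtain ⟨Γ, hΓ, e⟩ := hk k
    simp only [F, H, ← e]
    rw [← hΓ.tsum_approx_succ hK, ← ENNReal.tsum_add]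
    refine tsum_congr fun s => ?_
    rw [add_mul, add_comm]
    congr 1
    by_cases hz : (halt k).prob s = 0
    · simp [hz]
    · rw [hK'.approx_succ_of_not_can (hhalt k s hz)]
      simp
  have hsum : ∀ n k, F k n = ∑ j ∈ Finset.range n, H (k + j) := by
    intro n
    induction n with
    | zero => intro k; simp [F, approx_zero_coe]
    | succ n ih =>
      intro k
      rw [hF, ih, Finset.sum_range_succ', add_comm]
      simp only [add_zero, add_assoc, add_comm 1]
  have hout : (K.prune.outcome Λ' ω : ℝ≥0∞) = ∑' k, H k := by
    simp only [outcome, H]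
    rw [ENNReal.tsum_comm]
    refine tsum_congr fun s => ?_
    split_ifs <;> simp [hs]
  rw [hout, eval_eq_iSup_approx, expect_iSup _ (approx_mono K), ENNReal.tsum_eq_iSup_nat]
  refine iSup_congr fun n => ?_
  simp only [expect_coe, h₀]
  simpa using hsum n 0

/-! ### Unfolding a derivation into a resolution -/

namespace SubDist

variable {S R : Type*}

theorem tsum_bind_mul (Λ : SubDist S) (κ : S → PMF R) (g : R → ℝ≥0∞) :
    ∑' r, (Λ.bind κ).prob r * g r = ∑' s, Λ.prob s * ∑' r, κ s r * g r := by
  simp only [bind, ← ENNReal.tsum_mul_right, ← ENNReal.tsum_mul_left]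
  rw [ENNReal.tsum_comm]
  simp only [mul_assoc]

theorem map_bind_of_forall_map_eq_pure (Λ : SubDist S) {κ : S → PMF R} {f : R → S}
    (h : ∀ s, (κ s).map f = PMF.pure s) : (Λ.bind κ).map f = Λ := by
  classical
  ext x
  have key := tsum_bind_mul Λ κ fun r => if f r = x then 1 else 0
  have h' : ∀ s, ∑' r, κ s r * (if f r = x then 1 else 0) = if x = s then 1 else 0 := by
    intro s
    have := congrArg (fun q : PMF S => q x) (h s)
    rw [PMF.pure_apply, PMF.map_apply] at this
    rw [← this]
    refine tsum_congr fun r => ?_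
    rcases eq_or_ne (f r) x with rfl | h
    · simp
    · simp [h, h.symm]
  simp only [h'] at key
  simp only [map]
  simpa using key

end SubDist

variable {S Ω : Type*}

/-- The `k`-th layer over `s`: the next transition is drawn from `κ k s` and recorded in the
state. -/
noncomputable def layer (κ : ℕ → S → PMF (PMF S)) (k : ℕ) (s : S) : PMF (ℕ × S × PMF S) :=
  (κ k s).map fun D => (k, s, D)

theorem layer_map (κ : ℕ → S → PMF (PMF S)) (k : ℕ) (s : S) :
    (layer κ k s).map (fun r => r.2.1) = PMF.pure s := by
  rw [layer, PMF.map_comp]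
  exact PMF.map_const _ _

theorem tsum_layer_mul (κ : ℕ → S → PMF (PMF S)) (k : ℕ) (s : S)
    (g : ℕ × S × PMF S → ℝ≥0∞) : ∑' r, layer κ k s r * g r = ∑' D, κ k s D * g (k, s, D) := by
  have h := tsum_map_mul (fun D => (k, s, D)) (ofPMF (κ k s)) g
  rwa [map_ofPMF] at h

theorem bind_layer_prob_ne_zero (κ : ℕ → S → PMF (PMF S)) (k : ℕ) (Λ : SubDist S)
    (r : ℕ × S × PMF S) (h : (Λ.bind (layer κ k)).prob r ≠ 0) :
    r.1 = k ∧ Λ.prob r.2.1 ≠ 0 ∧ κ k r.2.1 r.2.2 ≠ 0 := by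
  obtain ⟨s, hs⟩ := (ENNReal.summable.tsum_ne_zero_iff).1 h
  have h₁ : r ∈ (layer κ k s).support := right_ne_zero_of_mul hs
  rw [layer, PMF.support_map] at h₁
  obtain ⟨D, hD, rfl⟩ := h₁
  exact ⟨rfl, left_ne_zero_of_mul hs, hD⟩

namespace PLTS

open Classical in
/-- The distribution `D` if it is an `α`-successor of `s`, and otherwise some `α`-successor of `s`,
if there is one. -/
noncomputable def follow (L : PLTS S Ω) (s : S) (α : Label Ω) (D : PMF S) : PMF S :=
  if L.trans s α D then D else if h : L.Can s α then h.choose else D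

theorem follow_of_trans {L : PLTS S Ω} {s : S} {α : Label Ω} {D : PMF S} (h : L.trans s α D) :
    L.follow s α D = D := if_pos h

theorem trans_follow {L : PLTS S Ω} {s : S} {α : Label Ω} (h : L.Can s α) (D : PMF S) :
    L.trans s α (L.follow s α D) := by
  unfold follow
  split_ifs with h₁
  · exact h₁
  · exact h.choose_spec

/-- The deterministic pLTS in which a state of `L` comes with a time and with the transition that
it takes next, drawn according to `κ`. -/
noncomputable def unfold (L : PLTS S Ω) (κ : ℕ → S → PMF (PMF S)) : PLTS (ℕ × S × PMF S) Ω :=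
  ⟨fun r α Λ => L.Can r.2.1 α ∧ Λ = (L.follow r.2.1 α r.2.2).bind (layer κ (r.1 + 1))⟩

theorem unfold_deterministic (L : PLTS S Ω) (κ : ℕ → S → PMF (PMF S)) :
    (L.unfold κ).Deterministic :=
  fun _ _ _ _ h h' => h.2.trans h'.2.symm

/-- Drawing the next choice does not change the underlying state. The fallback in `follow` provides
a transition for every enabled label, even where the stored distribution is not a successor for it.
-/
theorem unfold_resolves (L : PLTS S Ω) (κ : ℕ → S → PMF (PMF S)) :
    (L.unfold κ).Resolves L fun r => r.2.1 where
  trans := by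
    rintro r α _ ⟨hc, rfl⟩
    rw [PMF.map_bind]
    simp only [layer_map, PMF.bind_pure]
    exact trans_follow hc _
  can r α h := ⟨_, h, rfl⟩

theorem ExtremeDer.exists_unfold {L : PLTS S Ω} {Γ Γ' : SubDist S}
    (h : L.prune.ExtremeDer Γ Γ') :
    ∃ (κ : ℕ → S → PMF (PMF S)) (Λ' : SubDist (ℕ × S × PMF S)),
      (L.unfold κ).prune.ExtremeDer (Γ.bind (layer κ 0)) Λ' ∧ Λ'.map (fun r => r.2.1) = Γ' := by
  obtain ⟨⟨go, halt, h₀, hk, hs⟩, hst⟩ := h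
  choose Γs hΓ e using hk
  choose κ hκ hκΓ using fun k => Lift.exists_kernel (hΓ k)
  have hres := L.unfold_resolves κ
  have hmap : ∀ k (Λ : SubDist S), (Λ.bind (layer κ k)).map (fun r => r.2.1) = Λ := fun k Λ =>
    map_bind_of_forall_map_eq_pure Λ (layer_map κ k)
  -- On the support of the moving part the stored distribution is a genuine `τ`-successor, so
  -- `follow` returns it unchanged.
  let succ : ℕ × S × PMF S → PMF (ℕ × S × PMF S) := fun r => r.2.2.bind (layer κ (r.1 + 1))
  -- Executing the stored choices reproduces `Γs k`, by the defining property of `κ k`; fresh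
  -- choices for stage `k + 1` are drawn on arrival.
  have hstep : ∀ k, ((go k).bind (layer κ k)).bind succ = (Γs k).bind (layer κ (k + 1)) := by
    intro k
    ext x
    refine (tsum_bind_mul (go k) (layer κ k) fun r => succ r x).trans ?_
    simp only [tsum_layer_mul]
    simp only [succ, PMF.bind_apply, SubDist.bind, hκΓ,
      ← ENNReal.tsum_mul_left, ← ENNReal.tsum_mul_right]
    rw [ENNReal.tsum_comm (α := S) (β := S)]
    refine tsum_congr fun s => ?_
    rw [ENNReal.tsum_comm (α := S)]
    simp only [mul_assoc]
  have hadd : ∀ k {Λ Λ₁ Λ₂ : SubDist S}, (∀ s, Λ.prob s = Λ₁.prob s + Λ₂.prob s) →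
      ∀ r, (Λ.bind (layer κ k)).prob r =
        (Λ₁.bind (layer κ k)).prob r + (Λ₂.bind (layer κ k)).prob r := by
    intro k Λ Λ₁ Λ₂ h r
    simp only [SubDist.bind, h, add_mul, ENNReal.tsum_add]
  let Λ' : SubDist (ℕ × S × PMF S) := ⟨fun r => ∑' k, ((halt k).bind (layer κ k)).prob r, by
    rw [ENNReal.tsum_comm]
    simp only [mass_bind]
    rw [ENNReal.tsum_comm]
    simpa only [hs] using Γ'.mass_le_one⟩
  have hΛ' : Λ'.map (fun r => r.2.1) = Γ' := by
    ext s
    rw [map_tsum (Λ := Λ') _ (fun r => rfl), hs]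
    simp only [hmap]
  refine ⟨κ, Λ', ⟨⟨fun k => (go k).bind (layer κ k), fun k => (halt k).bind (layer κ k),
    hadd 0 h₀, fun k => ⟨_, ?_, hadd (k + 1) (e k)⟩, fun r => rfl⟩, fun r hr hc => ?_⟩, hΛ'⟩
  · rw [← hstep]
    refine Lift.bind _ _ fun r hr => ?_
    obtain ⟨rfl, h₁, h₂⟩ := bind_layer_prob_ne_zero κ k (go k) r hr
    obtain ⟨ht, hn⟩ := hκ _ _ _ h₁ h₂
    refine ⟨⟨⟨_, ht⟩, ?_⟩, by simpa only [hres.can_iff] using hn⟩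
    rw [follow_of_trans ht]
  · refine hst r.2.1 ?_ ((hres.prune.can_iff r _).2 hc)
    rw [← hΛ']
    exact prob_ne_zero_map _ Λ' r hr

end PLTS

theorem PLTS.SuccessPersistent.extremeDer_outcome_iff {S : Type u} {L : PLTS S Ω}
    (hL : L.SuccessPersistent) (Γ : SubDist S) (o : Ω → Prob) :
    (∃ Γ', L.prune.ExtremeDer Γ Γ' ∧ o = L.prune.outcome Γ') ↔
      ∃ (R : Type u) (K : PLTS R Ω) (Λ : SubDist R),
        IsResolution L Γ K Λ ∧ o = Λ.expect (eval K) := by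
  constructor
  · rintro ⟨Γ', h, rfl⟩
    obtain ⟨κ, Λ', hΛ', rfl⟩ := h.exists_unfold
    have hres := L.unfold_resolves κ
    refine ⟨_, L.unfold κ, Γ.bind (layer κ 0), ⟨L.unfold_deterministic κ, fun r => r.2.1,
      map_bind_of_forall_map_eq_pure Γ (layer_map κ 0), hres.trans, hres.can⟩, ?_⟩
    rw [hΛ'.expect_eval (L.unfold_deterministic κ) (hres.successPersistent hL),
      hres.prune.outcome_map]
  · rintro ⟨R, K, Λ, ⟨hK, f, rfl, ht, hc⟩, rfl⟩
    have hres : K.Resolves L f := ⟨ht, hc⟩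
    obtain ⟨Λ', hΛ'⟩ := K.prune.exists_extremeDer Λ
    refine ⟨Λ'.map f, hres.prune.extremeDer hΛ', ?_⟩
    rw [hΛ'.expect_eval hK (hres.successPersistent hL), hres.prune.outcome_map]

/-! ### Applications of tests to processes satisfy the success conditions -/

theorem mem_support_parDist {T P : Type*} {Θ : PMF T} {Δ : PMF P} {c : T × P}
    (h : c ∈ (parDist Θ Δ).support) : c.1 ∈ Θ.support ∧ c.2 ∈ Δ.support :=
  ⟨left_ne_zero_of_mul h, right_ne_zero_of_mul h⟩

theorem par_can_act {T P Act : Type*} (LT : PLTS T (Act ⊕ Ω)) (LP : PLTS P Act) (c : T × P)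
    (ω : Ω) : (par LT LP).Can c (.act ω) ↔ LT.Can c.1 (.act (.inr ω)) := by
  constructor
  · rintro ⟨_, h⟩
    cases h with
    | left_success t p ω Θ h => exact ⟨Θ, h⟩
  · rintro ⟨Θ, h⟩
    exact ⟨_, .left_success c.1 c.2 ω Θ h⟩

theorem PLTS.IsTest.par_successPersistent {T P Act : Type*} {LT : PLTS T (Act ⊕ Ω)}
    (h : LT.IsTest) (LP : PLTS P Act) : (par LT LP).SuccessPersistent where
  unique c ω₁ ω₂ := by
    simpa only [par_can_act] using h.unique c.1 ω₁ ω₂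
  persist c ω Δ := by
    simp only [par_can_act]
    intro hc ht u hu
    cases ht with
    | left_tau t p Θ ht => exact h.persist_tau t ω Θ hc ht _ (mem_support_parDist hu).1
    | right_tau t p Δ ht =>
      have := (mem_support_parDist hu).1
      rw [PMF.support_pure, Set.mem_singleton_iff] at this
      rwa [this]
    | sync t p a Θ Δ ht hp => exact h.persist_act t ω a Θ hc ht _ (mem_support_parDist hu).1

end ProbTest

theorem theorem3 {T : Type u} {P : Type v} {Act Ω : Type*}
    (LT : ProbTest.PLTS T (Act ⊕ Ω)) (hLT : LT.IsTest) (LP : ProbTest.PLTS P Act)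
    (Θ : PMF T) (Δ : PMF P) :
    ProbTest.derivationOutcomes LT LP Θ Δ = ProbTest.resolutionOutcomes LT LP Θ Δ :=
  Set.ext fun o => (hLT.par_successPersistent LP).extremeDer_outcome_iff _ o
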